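/- Let $1\le m<N$ be integers and let $H\in\mathbb C^{N\times N}$ be a Hermitian negative definite matrix with eigenvalues $\lambda_1\le\lambda_2\le\dots\le\lambda_N<0$, counted with multiplicity. For $X\in\mathbb C^{N\times m}$ and $\mu\ge 0$ put $$E_0(X)=\operatorname{tr}\bigl[(2I-X^*X)X^*HX\bigr],\qquad E_\mu(X)=E_0(X)+\mu\sum_{i,j}|X_{ij}|,$$ let $S_\mu\subseteq\mathbb C^{N\times m}$ be the set of global minimizers of $E_\mu$ over $\mathbb C^{N\times m}$, and for $A,B\subseteq\mathbb C^{N\times m}$ let $$d(A,B)=\sup_{a\in A}\inf_{b\in B}\|a-b\|_F,$$ where $\|\cdot\|_F$ is the Frobenius norm. Suppose that $\lambda_m<\lambda_{m+1}$ and let $\alpha\in(0,1)$. Then there exists $\mu_0=\mu_0(\alpha)>0$ (which may also depend on $H$, $N$ and $m$) such that for all $0<\mu<\mu_0$ the sets $S_0$ and $S_\mu$ are nonempty and $$d(S_\mu,S_0)\le\frac{\mu\sqrt{Nm}}{\alpha(\lambda_{m+1}-\lambda_m)}.$$ -/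

import Mathlib

open scoped Matrix ENNReal ComplexOrder

namespace OMM

/-- The eigenvalues of a Hermitian matrix, with multiplicity, in nondecreasing order:
`eig hH k` is the `(k + 1)`-st smallest eigenvalue. (Mathlib's `eigenvalues₀` is sorted in
nonincreasing order.) -/
noncomputable def eig {N : ℕ} {H : Matrix (Fin N) (Fin N) ℂ} (hH : H.IsHermitian)
    (k : Fin N) : ℝ :=
  hH.eigenvalues₀ (Fin.cast (Fintype.card_fin N).symm k.rev)

theorem eig_monotone {N : ℕ} {H : Matrix (Fin N) (Fin N) ℂ} (hH : H.IsHermitian) :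
    Monotone (eig hH) := by
  intro i j hij
  apply hH.eigenvalues₀_antitone
  simpa [Fin.le_def] using Fin.rev_le_rev.mpr hij

/-- The complex number `tr[(2I - X*X) X*HX]`. -/
noncomputable def traceE0 {N m : ℕ} (H : Matrix (Fin N) (Fin N) ℂ)
    (X : Matrix (Fin N) (Fin m) ℂ) : ℂ :=
  (((2 : ℂ) • (1 : Matrix (Fin m) (Fin m) ℂ) - Xᴴ * X) * (Xᴴ * H * X)).trace

/-- The orbital minimization functional `E₀(X) = tr[(2I - X*X) X*HX]`. The trace is real
when `H` is Hermitian (`E0_eq_traceE0`), so taking the real part loses nothing. -/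
noncomputable def E0 {N m : ℕ} (H : Matrix (Fin N) (Fin N) ℂ)
    (X : Matrix (Fin N) (Fin m) ℂ) : ℝ :=
  (traceE0 H X).re

theorem E0_eq_traceE0 {N m : ℕ} {H : Matrix (Fin N) (Fin N) ℂ} (hH : H.IsHermitian)
    (X : Matrix (Fin N) (Fin m) ℂ) : (E0 H X : ℂ) = traceE0 H X := by
  apply Complex.conj_eq_iff_re.mp
  have h : star (traceE0 H X) = traceE0 H X := by
    unfold traceE0
    rw [← Matrix.trace_conjTranspose, Matrix.conjTranspose_mul, Matrix.trace_mul_comm]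
    simp [Matrix.conjTranspose_mul, Matrix.conjTranspose_sub, hH.eq, Matrix.mul_assoc]
  exact h

/-- The entrywise `ℓ¹` norm. -/
noncomputable def l1Norm {N m : ℕ} (X : Matrix (Fin N) (Fin m) ℂ) : ℝ :=
  ∑ i, ∑ j, ‖X i j‖

/-- `E_μ(X) = E₀(X) + μ ‖X‖₁`. -/
noncomputable def E {N m : ℕ} (H : Matrix (Fin N) (Fin N) ℂ) (μ : ℝ)
    (X : Matrix (Fin N) (Fin m) ℂ) : ℝ :=
  E0 H X + μ * l1Norm X

/-- `S_μ = argmin E_μ`, the set of global minimizers of `E_μ` over all complex `N × m` matrices;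
for `μ = 0` it is the set of global minimizers of `E₀`. -/
def S {N : ℕ} (m : ℕ) (H : Matrix (Fin N) (Fin N) ℂ) (μ : ℝ) :
    Set (Matrix (Fin N) (Fin m) ℂ) :=
  {X | IsMinOn (E H μ) Set.univ X}

section

attribute [local instance] Matrix.frobeniusNormedAddCommGroup

/-- `d(A, B) = sup_{a ∈ A} inf_{b ∈ B} ‖a - b‖_F`, with the Frobenius norm, as an element of
`[0, ∞]`, so that no boundedness or non-emptiness is needed to give it its meaning. -/
noncomputable def d {N m : ℕ} (A B : Set (Matrix (Fin N) (Fin m) ℂ)) : ℝ≥0∞ :=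
  ⨆ a ∈ A, ⨅ b ∈ B, ENNReal.ofReal ‖a - b‖

end

end OMM

/-! Write `A = -H`, `a = -λ_m`, `b = -λ_{m+1}`, and let the columns of `V` be orthonormal
eigenvectors for `λ_1, …, λ_m`, so that `A V = V Λ`. Then `E₀` has minimum `-tr Λ`, attained at
every `V U` with `U` unitary; no other description of `S₀` is needed.

Split `X = V Y + Z` with `V* Z = 0` and put `q = ‖1 - Y*Y‖`. The excess `E₀(X) + tr Λ` is at least
`a q² + (a - b - (a + b) q) ‖Z‖²` (`quadratic_growth`), while the unitary polar factor `U` of `Y`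
satisfies `‖X - V U‖² ≤ q² + ‖Z‖²` (`exists_isometry_near`). Once `q ≤ (1 - α)(a - b)/(a + b)`, the
excess therefore dominates `α (a - b) D²`, where `D = ‖X - V U‖`.

For a minimizer `X` of `E_μ`, comparison with `V` bounds the excess by `μ ‖V‖₁`, which makes `q`
small for small `μ` (`norm_one_sub_gram_le`). Comparison with `V U` bounds the excess by `μ (‖V U‖₁
- ‖X‖₁) ≤ μ √(Nm) D`. Cancelling one factor `D` gives the estimate with its sharp linear dependence
on `μ`. -/

namespace OMM

open Matrix

attribute [local instance] Matrix.frobeniusNormedAddCommGroup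
attribute [local instance] Matrix.frobeniusNormedSpace

/-! ### Trace inequalities and the Frobenius norm -/

section Frobenius

variable {n k l : Type*} [Fintype n] [Fintype k] [Fintype l]

theorem frobenius_norm_sq_eq_sum (X : Matrix n k ℂ) : ‖X‖ ^ 2 = ∑ i, ∑ j, ‖X i j‖ ^ 2 := by
  rw [frobenius_norm_def, ← Real.sqrt_eq_rpow, Real.sq_sqrt]
  · simp
  · positivity

theorem frobenius_norm_sq (X : Matrix n k ℂ) : ‖X‖ ^ 2 = (Xᴴ * X).trace.re := by
  rw [frobenius_norm_sq_eq_sum, Finset.sum_comm]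
  simp only [trace, diag_apply, mul_apply, conjTranspose_apply, Complex.re_sum]
  refine Finset.sum_congr rfl fun j _ => Finset.sum_congr rfl fun i _ => ?_
  rw [Complex.star_def, ← Complex.normSq_eq_conj_mul_self, Complex.ofReal_re,
    Complex.normSq_eq_norm_sq]

theorem re_trace_nonneg {P : Matrix n n ℂ} (hP : P.PosSemidef) : 0 ≤ P.trace.re :=
  (Complex.nonneg_iff.mp hP.trace_nonneg).1

open scoped MatrixOrder in
-- By cyclicity the trace equals that of `√Q P √Q`, which is positive semidefinite.
theorem re_trace_mul_nonneg {P Q : Matrix n n ℂ} (hP : P.PosSemidef) (hQ : Q.PosSemidef) :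
    0 ≤ (P * Q).trace.re := by
  classical
  have h1 : CFC.sqrt Q * CFC.sqrt Q = Q := CFC.sqrt_mul_sqrt_self Q hQ.nonneg
  have h2 : (CFC.sqrt Q)ᴴ = CFC.sqrt Q := (CFC.sqrt_nonneg Q).posSemidef.isHermitian
  have h3 := hP.mul_mul_conjTranspose_same (CFC.sqrt Q)
  rw [h2] at h3
  rw [← h1, ← Matrix.mul_assoc, trace_mul_comm, ← Matrix.mul_assoc]
  exact re_trace_nonneg h3

theorem re_trace_real_smul (a : ℝ) (P : Matrix n n ℂ) : (a • P).trace.re = a * P.trace.re := by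
  simp [trace_smul]

theorem frobenius_norm_mul_le (X : Matrix n k ℂ) (Y : Matrix k l ℂ) : ‖X * Y‖ ≤ ‖X‖ * ‖Y‖ :=
  frobenius_nnnorm_mul X Y

theorem re_trace_conjTranspose_mul_le (X Y : Matrix n k ℂ) :
    (Xᴴ * Y).trace.re ≤ ‖X‖ * ‖Y‖ := by
  have key : (Xᴴ * Y).trace.re ≤ ∑ p : n × k, ‖X p.1 p.2‖ * ‖Y p.1 p.2‖ := by
    rw [Fintype.sum_prod_type, Finset.sum_comm]
    simp only [trace, diag_apply, mul_apply, conjTranspose_apply, Complex.re_sum]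
    gcongr with j _ i _
    exact (Complex.re_le_norm _).trans (by simp)
  have e : ∀ Z : Matrix n k ℂ, √(∑ p : n × k, ‖Z p.1 p.2‖ ^ 2) = ‖Z‖ := fun Z => by
    rw [← Real.sqrt_sq (norm_nonneg Z), frobenius_norm_sq_eq_sum]
    exact congrArg Real.sqrt (Fintype.sum_prod_type _)
  refine key.trans ((Real.sum_mul_le_sqrt_mul_sqrt _ _ _).trans_eq ?_)
  rw [e, e]

/-- The Frobenius norm dominates the operator norm. A vector is treated as a one-column matrix so
that the trace form of Cauchy–Schwarz applies. -/
theorem posSemidef_norm_smul_one_sub [DecidableEq n] {Q : Matrix n n ℂ} (hQ : Q.IsHermitian) :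
    (‖Q‖ • (1 : Matrix n n ℂ) - Q).PosSemidef := by
  have hh : (‖Q‖ • (1 : Matrix n n ℂ) - Q).IsHermitian := by
    unfold IsHermitian
    simp [conjTranspose_sub, conjTranspose_smul, hQ.eq]
  refine PosSemidef.of_dotProduct_mulVec_nonneg hh fun x => ?_
  rw [Complex.nonneg_iff]
  refine ⟨?_, (hh.im_star_dotProduct_mulVec_self x).symm⟩
  set c := replicateCol Unit x
  have h1 : star x ⬝ᵥ ((‖Q‖ • (1 : Matrix n n ℂ) - Q) *ᵥ x)
      = ‖Q‖ • (cᴴ * c).trace - (cᴴ * (Q * c)).trace := by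
    rw [sub_mulVec, dotProduct_sub, smul_mulVec, one_mulVec, dotProduct_smul]
    simp [c, trace, mul_apply, dotProduct, mulVec]
  rw [h1, Complex.sub_re, Complex.smul_re, ← frobenius_norm_sq, smul_eq_mul]
  have h2 := re_trace_conjTranspose_mul_le c (Q * c)
  have h3 := mul_le_mul_of_nonneg_left (frobenius_norm_mul_le Q c) (norm_nonneg c)
  linarith

end Frobenius

/-! ### Polar decomposition -/

/-- If `W` diagonalizes `X*X`, the columns of `X W` are orthogonal with squared norms `s j`. The
nonzero ones are normalized and completed to an orthonormal family, which is possible even for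
rank-deficient `X` because `m ≤ N`. -/
theorem exists_polar {N m : ℕ} (hmN : m ≤ N) (X : Matrix (Fin N) (Fin m) ℂ) :
    ∃ (U : Matrix (Fin N) (Fin m) ℂ) (R : Matrix (Fin m) (Fin m) ℂ),
      Uᴴ * U = 1 ∧ R.PosSemidef ∧ X = U * R := by
  have hS : (Xᴴ * X).PosSemidef := posSemidef_conjTranspose_mul_self X
  let W : Matrix (Fin m) (Fin m) ℂ := hS.1.eigenvectorUnitary
  have hW : Wᴴ * W = 1 := by
    simpa [W, star_eq_conjTranspose] using Unitary.coe_star_mul_self hS.1.eigenvectorUnitary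
  have hW' : W * Wᴴ = 1 := by
    simpa [W, star_eq_conjTranspose] using Unitary.coe_mul_star_self hS.1.eigenvectorUnitary
  set s := hS.1.eigenvalues
  have hs : ∀ i, 0 ≤ s i := hS.eigenvalues_nonneg
  have hspec : (X * W)ᴴ * (X * W) = diagonal (fun i => (s i : ℂ)) := by
    have h := hS.1.spectral_theorem
    rw [Unitary.conjStarAlgAut_apply] at h
    have h' : Xᴴ * X = W * diagonal (fun i => (s i : ℂ)) * Wᴴ := h
    rw [conjTranspose_mul, Matrix.mul_assoc, ← Matrix.mul_assoc Xᴴ, h', Matrix.mul_assoc _ _ W,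
      Matrix.mul_assoc, hW, Matrix.mul_one, ← Matrix.mul_assoc, hW, Matrix.one_mul]
  have hcol : ∀ i j, ∑ t, star ((X * W) t i) * (X * W) t j = if i = j then (s i : ℂ) else 0 := by
    intro i j
    have := congrFun (congrFun hspec i) j
    rwa [mul_apply, diagonal_apply] at this
  -- Indexed by `Fin N` to fit the basis extension; values outside `good` are irrelevant, since the
  -- extension only keeps `v` on `good`.
  let v : Fin N → EuclideanSpace ℂ (Fin N) := fun p =>
    if h : (p : ℕ) < m then
      WithLp.toLp 2 fun t => (((√(s ⟨p, h⟩))⁻¹ : ℝ) : ℂ) * (X * W) t ⟨p, h⟩ else 0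
  let good : Set (Fin N) := {p | ∃ h : (p : ℕ) < m, s ⟨p, h⟩ ≠ 0}
  have hv : Orthonormal ℂ (good.domRestrict v) := by
    rw [orthonormal_iff_ite]
    rintro ⟨p, hp, hp0⟩ ⟨q, hq, hq0⟩
    have e : inner ℂ (v p) (v q) = (((√(s ⟨p, hp⟩))⁻¹ : ℝ) : ℂ) * (((√(s ⟨q, hq⟩))⁻¹ : ℝ) : ℂ) *
        ∑ t, star ((X * W) t ⟨p, hp⟩) * (X * W) t ⟨q, hq⟩ := by
      simp only [v, hp, hq, dif_pos, PiLp.inner_apply, Finset.mul_sum]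
      refine Finset.sum_congr rfl fun t _ => ?_
      simp only [RCLike.inner_apply, map_mul, Complex.conj_ofReal, Complex.star_def]
      ring
    change inner ℂ (v p) (v q) = _
    rw [e, hcol]
    by_cases hpq : p = q
    · subst hpq
      have h1 : √(s ⟨p, hp⟩) ≠ 0 := by
        rw [Real.sqrt_ne_zero']; exact lt_of_le_of_ne (hs _) (Ne.symm hp0)
      simp only [if_true]
      rw [← Complex.ofReal_mul, ← Complex.ofReal_mul, ← Complex.ofReal_one]
      congr 1
      rw [← mul_inv, Real.mul_self_sqrt (hs _), inv_mul_cancel₀ hp0]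
    · have : ¬ ((⟨p, hp⟩ : Fin m) = ⟨q, hq⟩) := fun h => hpq (Fin.ext (by simpa using h))
      simp [this, hpq]
  obtain ⟨b, hb⟩ := hv.exists_orthonormalBasis_extension_of_card_eq (by simp)
  let U₁ : Matrix (Fin N) (Fin m) ℂ := of fun t j => b (Fin.castLE hmN j) t
  let D : Matrix (Fin m) (Fin m) ℂ := diagonal fun j => ((√(s j) : ℝ) : ℂ)
  have hU₁ : U₁ᴴ * U₁ = 1 := by
    ext i j
    have := orthonormal_iff_ite.mp b.orthonormal (Fin.castLE hmN i) (Fin.castLE hmN j)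
    rw [PiLp.inner_apply] at this
    simp only [mul_apply, conjTranspose_apply, U₁, of_apply, one_apply]
    simp only [RCLike.inner_apply] at this
    simp only [(Fin.castLE_injective hmN).eq_iff] at this
    rw [← this]
    exact Finset.sum_congr rfl fun t _ => mul_comm _ _
  have hXW : X * W = U₁ * D := by
    ext t j
    simp only [D, mul_diagonal]
    by_cases h0 : s j = 0
    · have h1 := hcol j j
      rw [if_pos rfl, h0] at h1
      have h2 : ∑ t, ‖(X * W) t j‖ ^ 2 = 0 := by
        have := congrArg Complex.re h1
        rw [Complex.re_sum] at this
        simpa [← Complex.normSq_eq_conj_mul_self, Complex.normSq_eq_norm_sq,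
          ← Complex.ofReal_pow] using this
      rw [Finset.sum_eq_zero_iff_of_nonneg (fun _ _ => by positivity)] at h2
      have h3 : (X * W) t j = 0 := by simpa using h2 t (Finset.mem_univ _)
      rw [h3, h0]; simp
    · have h1 : √(s j) ≠ 0 := by
        rw [Real.sqrt_ne_zero']; exact lt_of_le_of_ne (hs _) (Ne.symm h0)
      have h2 := hb (Fin.castLE hmN j) ⟨j.2, h0⟩
      have h3 : U₁ t j = (((√(s j))⁻¹ : ℝ) : ℂ) * (X * W) t j := by
        simp [U₁, h2, v]
      rw [h3, mul_comm, ← mul_assoc, ← Complex.ofReal_mul, mul_inv_cancel₀ h1]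
      simp
  refine ⟨U₁ * Wᴴ, W * D * Wᴴ, ?_, ?_, ?_⟩
  · rw [conjTranspose_mul, conjTranspose_conjTranspose, Matrix.mul_assoc,
      ← Matrix.mul_assoc U₁ᴴ, hU₁, Matrix.one_mul, hW']
  · refine PosSemidef.mul_mul_conjTranspose_same (posSemidef_diagonal_iff.mpr fun i => ?_) W
    exact_mod_cast Real.sqrt_nonneg _
  · rw [Matrix.mul_assoc, ← Matrix.mul_assoc Wᴴ, ← Matrix.mul_assoc Wᴴ, hW, Matrix.one_mul,
      ← Matrix.mul_assoc, ← hXW, Matrix.mul_assoc, hW', Matrix.mul_one]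

/-! ### Lower bounds for the excess energy -/

/-- Spectral data for a Hermitian matrix `A` with an isometry `V` onto an invariant subspace:
`A` is at least `a` on the range of `V`, at most `b` on its orthogonal complement, with
`0 < b < a`, and at least `c > 0` everywhere. -/
structure SpectralGap {N m : ℕ} (A : Matrix (Fin N) (Fin N) ℂ) (V : Matrix (Fin N) (Fin m) ℂ)
    (Λ : Matrix (Fin m) (Fin m) ℂ) (a b c : ℝ) : Prop where
  isometry : Vᴴ * V = 1
  isHermitian : A.IsHermitian
  isHermitian_block : Λ.IsHermitian
  mul_eq : A * V = V * Λ
  le_block : (Λ - a • (1 : Matrix (Fin m) (Fin m) ℂ)).PosSemidef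
  le_compl : (b • (1 : Matrix (Fin N) (Fin N) ℂ) - A +
    V * (Λ - b • (1 : Matrix (Fin m) (Fin m) ℂ)) * Vᴴ).PosSemidef
  le_all : (A - c • (1 : Matrix (Fin N) (Fin N) ℂ)).PosSemidef
  pos_c : 0 < c
  pos_b : 0 < b
  lt : b < a

section SpectralGap

variable {N m : ℕ}

theorem norm_one_sub_mul_conjTranspose (Y : Matrix (Fin m) (Fin m) ℂ) :
    ‖1 - Y * Yᴴ‖ ^ 2 = ‖1 - Yᴴ * Y‖ ^ 2 := by
  rw [frobenius_norm_sq, frobenius_norm_sq]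
  have e : (Y * Yᴴ * (Y * Yᴴ)).trace = (Yᴴ * Y * (Yᴴ * Y)).trace := by
    rw [Matrix.mul_assoc, trace_mul_comm]
    simp only [Matrix.mul_assoc]
  simp [Matrix.mul_sub, Matrix.sub_mul, trace_sub, e, trace_mul_comm Y Yᴴ]

/-- A positive semidefinite matrix is at least as close to `1` as its square. -/
theorem norm_sub_one_le {R : Matrix (Fin m) (Fin m) ℂ} (hR : R.PosSemidef) :
    ‖R - 1‖ ^ 2 ≤ ‖1 - R * R‖ ^ 2 := by
  have h0 : Rᴴ = R := hR.isHermitian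
  have h1 : (R + R + R * R).PosSemidef := by
    -- The difference of the two sides is `tr[(R - 1)(2R + R²)(R - 1)]`, because `(1 + R)² - 1 = 2R
    -- + R²`.
    have := posSemidef_conjTranspose_mul_self R
    rw [h0] at this
    exact (hR.add hR).add this
  have h2 := re_trace_nonneg (h1.mul_mul_conjTranspose_same (R - 1))
  rw [conjTranspose_sub, h0, conjTranspose_one] at h2
  rw [frobenius_norm_sq, frobenius_norm_sq, ← sub_nonneg, ← Complex.sub_re, ← trace_sub]
  refine h2.trans_eq ?_
  simp only [conjTranspose_sub, conjTranspose_mul, h0, conjTranspose_one]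
  congr 2
  noncomm_ring

theorem E0_neg (A : Matrix (Fin N) (Fin N) ℂ) (X : Matrix (Fin N) (Fin m) ℂ) :
    E0 (-A) X = (Xᴴ * X * (Xᴴ * A * X)).trace.re - 2 * (Xᴴ * A * X).trace.re := by
  simp only [E0, traceE0, Matrix.sub_mul, trace_sub, Matrix.mul_neg, Matrix.neg_mul, trace_neg,
    Matrix.smul_mul, Matrix.one_mul, trace_smul, smul_eq_mul, Complex.sub_re,
    Complex.neg_re, Complex.mul_re, Complex.re_ofNat, Complex.im_ofNat]
  ring

namespace SpectralGap

variable {A : Matrix (Fin N) (Fin N) ℂ} {V : Matrix (Fin N) (Fin m) ℂ}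
  {Λ : Matrix (Fin m) (Fin m) ℂ} {a b c : ℝ}

theorem conjTranspose_mul_eq (h : SpectralGap A V Λ a b c) : Vᴴ * A = Λ * Vᴴ := by
  have := congrArg conjTranspose h.mul_eq
  rwa [conjTranspose_mul, conjTranspose_mul, h.isHermitian.eq, h.isHermitian_block.eq] at this

theorem conjTranspose_mul_compl (h : SpectralGap A V Λ a b c) (X : Matrix (Fin N) (Fin m) ℂ) :
    Vᴴ * (X - V * (Vᴴ * X)) = 0 := by
  rw [Matrix.mul_sub, ← Matrix.mul_assoc, h.isometry, Matrix.one_mul, sub_self]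

theorem gram_add (h : SpectralGap A V Λ a b c) {Y : Matrix (Fin m) (Fin m) ℂ}
    {Z : Matrix (Fin N) (Fin m) ℂ} (hZ : Vᴴ * Z = 0) :
    (V * Y + Z)ᴴ * (V * Y + Z) = Yᴴ * Y + Zᴴ * Z := by
  have hZ' : Zᴴ * V = 0 := by simpa using congrArg conjTranspose hZ
  have e1 : Yᴴ * Vᴴ * (V * Y) = Yᴴ * Y := by
    rw [Matrix.mul_assoc, ← Matrix.mul_assoc Vᴴ, h.isometry, Matrix.one_mul]
  have e2 : Yᴴ * Vᴴ * Z = 0 := by rw [Matrix.mul_assoc, hZ, Matrix.mul_zero]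
  have e3 : Zᴴ * (V * Y) = 0 := by rw [← Matrix.mul_assoc, hZ', Matrix.zero_mul]
  rw [conjTranspose_add, conjTranspose_mul, Matrix.add_mul, Matrix.mul_add, Matrix.mul_add, e1,
    e2, e3, add_zero, zero_add]

theorem energy_add (h : SpectralGap A V Λ a b c) {Y : Matrix (Fin m) (Fin m) ℂ}
    {Z : Matrix (Fin N) (Fin m) ℂ} (hZ : Vᴴ * Z = 0) :
    (V * Y + Z)ᴴ * A * (V * Y + Z) = Yᴴ * Λ * Y + Zᴴ * A * Z := by
  have hZ' : Zᴴ * V = 0 := by simpa using congrArg conjTranspose hZ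
  have e1 : Yᴴ * Vᴴ * A * (V * Y) = Yᴴ * Λ * Y := by
    rw [Matrix.mul_assoc Yᴴ, h.conjTranspose_mul_eq, Matrix.mul_assoc, Matrix.mul_assoc,
      ← Matrix.mul_assoc Vᴴ, h.isometry, Matrix.one_mul, Matrix.mul_assoc]
  have e2 : Yᴴ * Vᴴ * A * Z = 0 := by
    rw [Matrix.mul_assoc Yᴴ, h.conjTranspose_mul_eq, Matrix.mul_assoc, Matrix.mul_assoc, hZ,
      Matrix.mul_zero, Matrix.mul_zero]
  have e3 : Zᴴ * A * (V * Y) = 0 := by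
    rw [Matrix.mul_assoc, ← Matrix.mul_assoc A, h.mul_eq, ← Matrix.mul_assoc, ← Matrix.mul_assoc,
      hZ', Matrix.zero_mul, Matrix.zero_mul]
  rw [conjTranspose_add, conjTranspose_mul, Matrix.add_mul, Matrix.add_mul, Matrix.mul_add,
    Matrix.mul_add, e1, e2, e3, add_zero, zero_add]

theorem posSemidef_compl (h : SpectralGap A V Λ a b c) {Z : Matrix (Fin N) (Fin m) ℂ}
    (hZ : Vᴴ * Z = 0) : (b • (Zᴴ * Z) - Zᴴ * A * Z).PosSemidef := by
  have := h.le_compl.conjTranspose_mul_mul_same Z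
  rw [Matrix.mul_add, Matrix.add_mul, Matrix.mul_assoc Zᴴ (V * _ * _), Matrix.mul_assoc (V * _),
    hZ, Matrix.mul_zero, Matrix.mul_zero, add_zero, Matrix.mul_sub, Matrix.sub_mul] at this
  simpa using this

theorem posSemidef_energy (h : SpectralGap A V Λ a b c) (Z : Matrix (Fin N) (Fin m) ℂ) :
    (Zᴴ * A * Z - c • (Zᴴ * Z)).PosSemidef := by
  have := h.le_all.conjTranspose_mul_mul_same Z
  rw [Matrix.mul_sub, Matrix.sub_mul] at this
  simpa using this

theorem energy_nonneg (h : SpectralGap A V Λ a b c) (Z : Matrix (Fin N) (Fin m) ℂ) :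
    (Zᴴ * A * Z).PosSemidef := by
  simpa using (h.posSemidef_energy Z).add ((posSemidef_conjTranspose_mul_self Z).smul h.pos_c.le)

theorem posSemidef_block (h : SpectralGap A V Λ a b c) (Y : Matrix (Fin m) (Fin m) ℂ) :
    (Yᴴ * Λ * Y - a • (Yᴴ * Y)).PosSemidef := by
  have := h.le_block.conjTranspose_mul_mul_same Y
  rw [Matrix.mul_sub, Matrix.sub_mul] at this
  simpa using this

/-- Quadratic growth of `E₀` in terms of the components along and orthogonal to `V`. -/
theorem quadratic_growth (h : SpectralGap A V Λ a b c) {Y : Matrix (Fin m) (Fin m) ℂ}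
    {Z : Matrix (Fin N) (Fin m) ℂ} (hZ : Vᴴ * Z = 0) :
    a * ‖1 - Yᴴ * Y‖ ^ 2 + (a - b - (a + b) * ‖1 - Yᴴ * Y‖) * ‖Z‖ ^ 2 ≤
      E0 (-A) (V * Y + Z) + Λ.trace.re := by
  rw [E0_neg, h.gram_add hZ, h.energy_add hZ, ← norm_one_sub_mul_conjTranspose]
  -- The part of the excess free of `Z` is `tr[(1 - YY*) Λ (1 - YY*)]`, at least `a q²` since `Λ ≥
  -- a`.
  have h1 := re_trace_nonneg (h.le_block.mul_mul_conjTranspose_same (1 - Y * Yᴴ))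
  have e1 : ((1 - Y * Yᴴ) * (Λ - a • (1 : Matrix (Fin m) (Fin m) ℂ)) * (1 - Y * Yᴴ)ᴴ).trace.re =
      Λ.trace.re - 2 * (Yᴴ * Λ * Y).trace.re + (Yᴴ * Y * (Yᴴ * Λ * Y)).trace.re
        - a * ‖1 - Y * Yᴴ‖ ^ 2 := by
    have t1 : (Λ * (Y * Yᴴ)).trace = (Yᴴ * Λ * Y).trace := by
      rw [← Matrix.mul_assoc, trace_mul_comm, Matrix.mul_assoc]
    have t2 : (Y * Yᴴ * Λ).trace = (Yᴴ * Λ * Y).trace := by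
      rw [Matrix.mul_assoc, trace_mul_comm]
    have t3 : (Y * Yᴴ * Λ * (Y * Yᴴ)).trace = (Yᴴ * Y * (Yᴴ * Λ * Y)).trace := by
      rw [← Matrix.mul_assoc, trace_mul_comm]
      simp only [Matrix.mul_assoc]
    rw [norm_one_sub_mul_conjTranspose, ← norm_one_sub_mul_conjTranspose, frobenius_norm_sq,
      trace_mul_comm (1 - Y * Yᴴ)ᴴ, Matrix.mul_sub, Matrix.sub_mul, trace_sub, Complex.sub_re,
      Matrix.mul_smul, Matrix.mul_one, Matrix.smul_mul, re_trace_real_smul]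
    congr 1
    have : (1 - Y * Yᴴ) * Λ * (1 - Y * Yᴴ)ᴴ =
        Λ - Λ * (Y * Yᴴ) - Y * Yᴴ * Λ + Y * Yᴴ * Λ * (Y * Yᴴ) := by
      rw [conjTranspose_sub, conjTranspose_one, conjTranspose_mul, conjTranspose_conjTranspose]
      noncomm_ring
    rw [this, trace_add, trace_sub, trace_sub, t1, t2, t3]
    simp only [Complex.add_re, Complex.sub_re]
    ring
  rw [e1] at h1
  have hM : Yᴴ * Y = 1 - (1 - Yᴴ * Y) := by abel
  have hq : ‖1 - Y * Yᴴ‖ = ‖1 - Yᴴ * Y‖ :=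
    (sq_eq_sq₀ (norm_nonneg _) (norm_nonneg _)).mp (norm_one_sub_mul_conjTranspose Y)
  have hQ : (1 - Yᴴ * Y).IsHermitian := by
    simp [IsHermitian, conjTranspose_sub, conjTranspose_mul]
  have hT := posSemidef_conjTranspose_mul_self Z
  have hG := h.energy_nonneg Z
  -- With `T = Z*Z`, `G = Z*AZ`, `M = Y*Y`, `L = Y*ΛY`, the rest is `tr(MG) + tr(TL) + tr(TG) - 2 tr
  -- G`. Here `L ≥ aM`, `M ≥ 1 - q`, `tr(TG) ≥ 0` and `G ≤ bT` leave the coefficient `a(1 - q) - b(1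
  -- + q)` of `‖Z‖²`.
  have h2 := re_trace_mul_nonneg hT (h.posSemidef_block Y)
  have h3 := re_trace_mul_nonneg (posSemidef_norm_smul_one_sub hQ) hT
  have h4 := re_trace_nonneg (h.posSemidef_compl hZ)
  have h5 := re_trace_mul_nonneg (posSemidef_norm_smul_one_sub hQ) hG
  have h6 := re_trace_mul_nonneg hT hG
  have hTn := frobenius_norm_sq Z
  rw [hq] at h1 ⊢
  set q := ‖1 - Yᴴ * Y‖ with hqdef
  have hq0 : 0 ≤ q := norm_nonneg _
  generalize Zᴴ * A * Z = G at *
  generalize Zᴴ * Z = T at *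
  generalize Yᴴ * Λ * Y = L at *
  generalize Yᴴ * Y = M at *
  simp only [Matrix.sub_mul, Matrix.mul_sub, Matrix.add_mul, Matrix.mul_add, trace_sub, trace_add,
    Complex.sub_re, Complex.add_re, Matrix.smul_mul, Matrix.mul_smul, re_trace_real_smul,
    Matrix.one_mul, trace_mul_comm T M] at *
  rw [hTn]
  have h7 := mul_nonneg hq0 h4
  have hab : 0 ≤ a := h.pos_b.le.trans h.lt.le
  have h8 := mul_nonneg hab h3
  nlinarith

/-- Ky Fan's inequality, with the excess. -/
theorem ky_fan (h : SpectralGap A V Λ a b c) {U : Matrix (Fin N) (Fin m) ℂ} (hU : Uᴴ * U = 1) :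
    (Uᴴ * A * U).trace.re + (a - b) * ‖U - V * (Vᴴ * U)‖ ^ 2 ≤ Λ.trace.re := by
  have hZ := h.conjTranspose_mul_compl U
  set Z := U - V * (Vᴴ * U) with hZdef
  set Y := Vᴴ * U with hYdef
  have hUYZ : U = V * Y + Z := by rw [hZdef]; abel
  have hgram : Yᴴ * Y + Zᴴ * Z = 1 := by rw [← h.gram_add hZ, ← hUYZ, hU]
  have hen : Uᴴ * A * U = Yᴴ * Λ * Y + Zᴴ * A * Z := by rw [← h.energy_add hZ, ← hUYZ]
  -- This is the Gram matrix of `V - UU*V`. Its trace equals `‖Z‖²`, so `Λ ≥ a` gains `a ‖Z‖²` while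
  -- `Z*AZ` costs at most `b ‖Z‖²`.
  have hP : (1 - Y * Yᴴ).PosSemidef := by
    have := posSemidef_conjTranspose_mul_self (V - U * (Uᴴ * V))
    convert this using 1
    have e1 : Vᴴ * (U * (Uᴴ * V)) = Y * Yᴴ := by
      simp [hYdef, conjTranspose_mul, Matrix.mul_assoc]
    have e2 : Vᴴ * U * Uᴴ * (U * (Uᴴ * V)) = Y * Yᴴ := by
      rw [Matrix.mul_assoc _ Uᴴ, ← Matrix.mul_assoc Uᴴ, hU, Matrix.one_mul]
      simp [hYdef, conjTranspose_mul]
    have e3 : Vᴴ * U * Uᴴ * V = Y * Yᴴ := by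
      simp [hYdef, conjTranspose_mul, Matrix.mul_assoc]
    simp only [conjTranspose_sub, conjTranspose_mul, conjTranspose_conjTranspose, Matrix.sub_mul,
      Matrix.mul_sub, h.isometry, e1, e2, e3]
    abel
  have h1 := re_trace_mul_nonneg h.le_block hP
  have h2 := re_trace_nonneg (h.posSemidef_compl hZ)
  have t1 : (Λ * (Y * Yᴴ)).trace = (Yᴴ * Λ * Y).trace := by
    rw [← Matrix.mul_assoc, trace_mul_comm, Matrix.mul_assoc]
  have t2 := congrArg (fun M => (trace M).re) hgram
  have hTn := frobenius_norm_sq Z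
  rw [hen, hTn, trace_add, Complex.add_re]
  simp only [Matrix.sub_mul, Matrix.mul_sub, trace_sub, trace_add,
    Complex.sub_re, Complex.add_re, Matrix.smul_mul, re_trace_real_smul,
    Matrix.one_mul, Matrix.mul_one, t1, trace_mul_comm Y] at h1 h2 t2
  have t3 := congrArg (a * ·) t2
  linarith

/-- Lower bound for `E₀`, with the excess in terms of a polar decomposition. -/
theorem energy_excess (h : SpectralGap A V Λ a b c) {U : Matrix (Fin N) (Fin m) ℂ}
    {R : Matrix (Fin m) (Fin m) ℂ} (hU : Uᴴ * U = 1) (hR : R.IsHermitian) :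
    c * ‖1 - R * R‖ ^ 2 + (a - b) * ‖U - V * (Vᴴ * U)‖ ^ 2 ≤
      E0 (-A) (U * R) + Λ.trace.re := by
  have h1 := h.ky_fan hU
  have h2 := h.posSemidef_energy U
  rw [hU] at h2
  -- The excess is `tr[(1 - R²) U*AU (1 - R²)]` plus the Ky Fan deficit `tr Λ - tr U*AU`; the first
  -- term uses `U*AU ≥ c`.
  have h3 := re_trace_nonneg (h2.mul_mul_conjTranspose_same (1 - R * R))
  have e1 : (U * R)ᴴ * (U * R) = R * R := by
    rw [conjTranspose_mul, hR.eq, Matrix.mul_assoc, ← Matrix.mul_assoc Uᴴ, hU, Matrix.one_mul]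
  have e2 : (U * R)ᴴ * A * (U * R) = R * (Uᴴ * A * U) * R := by
    rw [conjTranspose_mul, hR.eq]; simp only [Matrix.mul_assoc]
  have hK : (1 - R * R)ᴴ = 1 - R * R := by
    rw [conjTranspose_sub, conjTranspose_one, conjTranspose_mul, hR.eq]
  rw [E0_neg, e1, e2, frobenius_norm_sq]
  rw [hK] at h3 ⊢
  generalize Uᴴ * A * U = B at *
  have e3 : ((1 - R * R) * (B - c • (1 : Matrix (Fin m) (Fin m) ℂ)) * (1 - R * R)).trace.re =
      B.trace.re - 2 * (R * B * R).trace.re + (R * R * (R * B * R)).trace.re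
        - c * ((1 - R * R) * (1 - R * R)).trace.re := by
    have t0 : (1 - R * R) * (B - c • (1 : Matrix (Fin m) (Fin m) ℂ)) * (1 - R * R) =
        B - B * (R * R) - R * R * B + R * R * B * (R * R)
          - c • ((1 - R * R) * (1 - R * R)) := by
      have hc : ∀ K : Matrix (Fin m) (Fin m) ℂ,
          K * (B - c • (1 : Matrix (Fin m) (Fin m) ℂ)) * K = K * B * K - c • (K * K) := fun K => by
        rw [Matrix.mul_sub, Matrix.sub_mul, Matrix.mul_smul, Matrix.mul_one, Matrix.smul_mul]
      rw [hc]
      congr 1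
      noncomm_ring
    have t1 : (B * (R * R)).trace = (R * B * R).trace := by
      rw [← Matrix.mul_assoc, trace_mul_comm, Matrix.mul_assoc]
    have t2 : (R * R * B).trace = (R * B * R).trace := by
      rw [Matrix.mul_assoc, trace_mul_comm]
    have t3 : (R * R * B * (R * R)).trace = (R * R * (R * B * R)).trace := by
      rw [← Matrix.mul_assoc, trace_mul_comm]
      simp only [Matrix.mul_assoc]
    rw [t0, trace_sub, trace_add, trace_sub, trace_sub, t1, t2, t3]
    simp only [Complex.add_re, Complex.sub_re, re_trace_real_smul]
    ring
  rw [e3] at h3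
  linarith

theorem E0_isometry (h : SpectralGap A V Λ a b c) {U : Matrix (Fin m) (Fin m) ℂ}
    (hU : Uᴴ * U = 1) : E0 (-A) (V * U) = -Λ.trace.re := by
  have hZ : Vᴴ * (0 : Matrix (Fin N) (Fin m) ℂ) = 0 := Matrix.mul_zero _
  have e1 := h.gram_add (Y := U) hZ
  have e2 := h.energy_add (Y := U) hZ
  simp only [add_zero, conjTranspose_zero, Matrix.zero_mul, Matrix.mul_zero] at e1 e2
  rw [E0_neg, e1, e2, hU, Matrix.one_mul, trace_mul_comm, ← Matrix.mul_assoc,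
    mul_eq_one_comm.mp hU, Matrix.one_mul]
  ring

end SpectralGap

end SpectralGap

/-! ### Spectral data from the ordered eigenvalues -/

theorem real_smul_one_eq_diagonal {n : Type*} [DecidableEq n] (r : ℝ) :
    r • (1 : Matrix n n ℂ) = diagonal fun _ => (r : ℂ) := by
  ext i j
  by_cases h : i = j <;> simp [h, one_apply]

theorem real_smul_one_eq_conj {n : Type*} [Fintype n] [DecidableEq n] {W : Matrix n n ℂ}
    (hW : W * Wᴴ = 1) (r : ℝ) : r • (1 : Matrix n n ℂ) = W * (diagonal fun _ => (r : ℂ)) * Wᴴ := by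
  rw [← real_smul_one_eq_diagonal, Matrix.mul_smul, Matrix.mul_one, Matrix.smul_mul, hW]

theorem exists_eq_conj_diagonal_eig {N : ℕ} {H : Matrix (Fin N) (Fin N) ℂ} (hH : H.IsHermitian) :
    ∃ W : Matrix (Fin N) (Fin N) ℂ, Wᴴ * W = 1 ∧
      H = W * diagonal (fun k => (eig hH k : ℂ)) * Wᴴ := by
  -- Matches the nondecreasing order of `eig` with the indexing of `eigenvalues`, hence of the
  -- eigenvector columns.
  let σ : Fin N ≃ Fin N := (Fin.revPerm.trans (finCongr (Fintype.card_fin N).symm)).trans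
    (Fintype.equivOfCardEq (Fintype.card_fin _))
  let U : Matrix (Fin N) (Fin N) ℂ := hH.eigenvectorUnitary
  have hU : Uᴴ * U = 1 := by
    simpa [U, star_eq_conjTranspose] using Unitary.coe_star_mul_self hH.eigenvectorUnitary
  have hspec : H = U * diagonal (fun i => (hH.eigenvalues i : ℂ)) * Uᴴ := by
    have h := hH.spectral_theorem
    rw [Unitary.conjStarAlgAut_apply] at h
    exact h
  have hσ : ∀ k, eig hH k = hH.eigenvalues (σ k) := fun k => by
    simp [eig, IsHermitian.eigenvalues, σ]
  refine ⟨U.submatrix id σ, ?_, ?_⟩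
  · rw [conjTranspose_submatrix, ← submatrix_mul _ _ _ _ _ Function.bijective_id, hU,
      submatrix_one_equiv]
  · have hD : diagonal (fun k => (eig hH k : ℂ)) =
        (diagonal fun i => (hH.eigenvalues i : ℂ)).submatrix σ σ := by
      rw [submatrix_diagonal_equiv]
      congr 1
      ext k
      simp [hσ]
    rw [hD, conjTranspose_submatrix, submatrix_mul_equiv, submatrix_mul_equiv, ← hspec]
    rfl

theorem eig_neg {N : ℕ} {H : Matrix (Fin N) (Fin N) ℂ} (hH : H.IsHermitian)
    (hneg : (-H).PosDef) (k : Fin N) : eig hH k < 0 := by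
  obtain ⟨W, hW, hHW⟩ := exists_eq_conj_diagonal_eig hH
  have hinj : Function.Injective W.mulVec := fun x y hxy => by
    simpa [mulVec_mulVec, hW] using congrArg (Wᴴ *ᵥ ·) hxy
  have h := (hneg.conjTranspose_mul_mul_same hinj).diag_pos (i := k)
  have e : Wᴴ * (-H) * W = -diagonal (fun k => (eig hH k : ℂ)) := by
    conv_lhs => rw [hHW]
    rw [Matrix.mul_neg, Matrix.neg_mul, Matrix.mul_assoc W, ← Matrix.mul_assoc Wᴴ, hW,
      Matrix.one_mul, Matrix.mul_assoc, hW, Matrix.mul_one]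
  rw [e, Matrix.neg_apply, diagonal_apply_eq, ← Complex.ofReal_neg, ← Complex.ofReal_zero,
    Complex.real_lt_real] at h
  linarith

theorem exists_spectralGap {N m : ℕ} (hm : 0 < m) (hmN : m < N) (hm1 : m - 1 < N)
    {H : Matrix (Fin N) (Fin N) ℂ} (hH : H.IsHermitian) (hneg : (-H).PosDef)
    (hgap : eig hH ⟨m - 1, hm1⟩ < eig hH ⟨m, hmN⟩) :
    ∃ (V : Matrix (Fin N) (Fin m) ℂ) (Λ : Matrix (Fin m) (Fin m) ℂ) (c : ℝ),
      SpectralGap (-H) V Λ (-eig hH ⟨m - 1, hm1⟩) (-eig hH ⟨m, hmN⟩) c := by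
  obtain ⟨W, hW, hHW⟩ := exists_eq_conj_diagonal_eig hH
  have hW' : W * Wᴴ = 1 := mul_eq_one_comm.mp hW
  let ι : Fin m → Fin N := Fin.castLE hmN.le
  have hι : Function.Injective ι := Fin.castLE_injective hmN.le
  set f : Fin N → ℝ := fun k => -eig hH k with hf
  have hA : -H = W * diagonal (fun k => (f k : ℂ)) * Wᴴ := by
    conv_lhs => rw [hHW]
    rw [← Matrix.neg_mul, ← Matrix.mul_neg, diagonal_neg]
    simp [f]
  -- Selects the first `m` coordinates, so `W * J` consists of the eigenvectors for the `m` lowest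
  -- eigenvalues of `H`.
  let J : Matrix (Fin N) (Fin m) ℂ := of fun t j => if t = ι j then 1 else 0
  have hJ : Jᴴ * J = 1 := by
    ext i j
    simp [J, mul_apply, one_apply, hι.eq_iff, eq_comm]
  have hDJ : diagonal (fun k => (f k : ℂ)) * J = J * diagonal (fun j => (f (ι j) : ℂ)) := by
    ext t j
    rw [diagonal_mul, mul_diagonal]
    by_cases h : t = ι j <;> simp [J, h]
  have hJDJ : ∀ g : Fin N → ℝ, J * diagonal (fun j => (g (ι j) : ℂ)) * Jᴴ =
      diagonal fun k : Fin N => if (k : ℕ) < m then (g k : ℂ) else 0 := by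
    intro g
    ext s t
    rw [mul_apply, diagonal_apply]
    simp only [mul_diagonal, conjTranspose_apply, J, of_apply]
    by_cases hs : (s : ℕ) < m
    · have h1 : s = ι ⟨s, hs⟩ := rfl
      rw [Finset.sum_eq_single ⟨s, hs⟩]
      · rw [← h1]
        by_cases hst : s = t
        · simp [← hst, hs]
        · simp [hst, Ne.symm hst]
      · intro j _ hj
        have : s ≠ ι j := fun h => hj (hι (h.symm.trans h1))
        simp [this]
      · simp
    · rw [Finset.sum_eq_zero]
      · simp [hs]
      · intro j _
        have : s ≠ ι j := fun h => hs (by rw [h]; exact j.2)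
        simp [this]
  have hanti : ∀ {i j : Fin N}, i ≤ j → f j ≤ f i := fun hij => neg_le_neg (eig_monotone hH hij)
  refine ⟨W * J, diagonal fun j => (f (ι j) : ℂ), f ⟨N - 1, by omega⟩, ?_⟩
  constructor
  · rw [conjTranspose_mul, Matrix.mul_assoc, ← Matrix.mul_assoc Wᴴ, hW, Matrix.one_mul, hJ]
  · exact hneg.isHermitian
  · rw [IsHermitian, diagonal_conjTranspose]
    congr 1
    ext j
    simp
  · rw [hA, Matrix.mul_assoc, ← Matrix.mul_assoc Wᴴ, hW, Matrix.one_mul, Matrix.mul_assoc, hDJ,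
      Matrix.mul_assoc]
  · rw [real_smul_one_eq_diagonal, diagonal_sub, posSemidef_diagonal_iff]
    intro j
    rw [← Complex.ofReal_sub, ← Complex.ofReal_zero, Complex.real_le_real, sub_nonneg]
    exact hanti (Fin.le_def.mpr (by simp [ι]; omega))
  · have e : (-eig hH ⟨m, hmN⟩) • (1 : Matrix (Fin N) (Fin N) ℂ) - -H + W * J *
        ((diagonal fun j => (f (ι j) : ℂ)) - (-eig hH ⟨m, hmN⟩) • 1) * (W * J)ᴴ =
        W * (diagonal fun k : Fin N => if (k : ℕ) < m then 0 else ((f ⟨m, hmN⟩ - f k : ℝ) : ℂ)) * Wᴴ := by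
      have e1 : W * J * ((diagonal fun j => (f (ι j) : ℂ)) - (-eig hH ⟨m, hmN⟩) • 1) * (W * J)ᴴ
          = W * (J * (diagonal fun j => ((f (ι j) - f ⟨m, hmN⟩ : ℝ) : ℂ)) * Jᴴ) * Wᴴ := by
        rw [real_smul_one_eq_diagonal, diagonal_sub, conjTranspose_mul]
        simp only [Matrix.mul_assoc, Complex.ofReal_sub]
        rfl
      have e2 : (-eig hH ⟨m, hmN⟩) • (1 : Matrix (Fin N) (Fin N) ℂ) =
          W * (diagonal fun _ => (f ⟨m, hmN⟩ : ℂ)) * Wᴴ := real_smul_one_eq_conj hW' _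
      rw [e1, hJDJ (fun k => f k - f ⟨m, hmN⟩), e2, hA, ← Matrix.sub_mul, ← Matrix.mul_sub,
        ← Matrix.add_mul, ← Matrix.mul_add, diagonal_sub, diagonal_add]
      congr 3
      ext k
      split_ifs <;> simp
    rw [e]
    refine PosSemidef.mul_mul_conjTranspose_same (posSemidef_diagonal_iff.mpr fun k => ?_) W
    split_ifs with hk
    · exact le_rfl
    · rw [← Complex.ofReal_zero, Complex.real_le_real, sub_nonneg]
      exact hanti (Fin.le_def.mpr (by simpa using hk))
  · have e : -H - f ⟨N - 1, by omega⟩ • (1 : Matrix (Fin N) (Fin N) ℂ) =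
        W * (diagonal fun k => ((f k - f ⟨N - 1, by omega⟩ : ℝ) : ℂ)) * Wᴴ := by
      rw [real_smul_one_eq_conj hW', hA, ← Matrix.sub_mul, ← Matrix.mul_sub, diagonal_sub]
      simp
    rw [e]
    refine PosSemidef.mul_mul_conjTranspose_same (posSemidef_diagonal_iff.mpr fun k => ?_) W
    rw [← Complex.ofReal_zero, Complex.real_le_real, sub_nonneg]
    exact hanti (Fin.le_def.mpr (by simp; omega))
  · exact neg_pos.mpr (eig_neg hH hneg _)
  · exact neg_pos.mpr (eig_neg hH hneg _)
  · exact neg_lt_neg hgap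

/-! ### Almost minimal energy and nearby minimizers -/

namespace SpectralGap

variable {N m : ℕ} {A : Matrix (Fin N) (Fin N) ℂ} {V : Matrix (Fin N) (Fin m) ℂ}
  {Λ : Matrix (Fin m) (Fin m) ℂ} {a b c : ℝ}

/-- Supplies both the minimum value of `E₀` and its coercivity. -/
theorem gram_lower_bound (h : SpectralGap A V Λ a b c) (hmN : m ≤ N)
    (X : Matrix (Fin N) (Fin m) ℂ) :
    c * ‖1 - Xᴴ * X‖ ^ 2 ≤ E0 (-A) X + Λ.trace.re := by
  obtain ⟨U, R, hU, hR, rfl⟩ := exists_polar hmN X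
  have h1 := h.energy_excess hU hR.isHermitian
  have e1 : (U * R)ᴴ * (U * R) = R * R := by
    rw [conjTranspose_mul, hR.isHermitian.eq, Matrix.mul_assoc, ← Matrix.mul_assoc Uᴴ, hU,
      Matrix.one_mul]
  rw [e1]
  have := mul_nonneg (sub_nonneg.mpr h.lt.le) (sq_nonneg ‖U - V * (Vᴴ * U)‖)
  linarith

theorem le_E0 (h : SpectralGap A V Λ a b c) (hmN : m ≤ N) (X : Matrix (Fin N) (Fin m) ℂ) :
    -Λ.trace.re ≤ E0 (-A) X := by
  have := h.gram_lower_bound hmN X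
  have := mul_nonneg h.pos_c.le (sq_nonneg ‖1 - Xᴴ * X‖)
  linarith

/-- Matrices of almost minimal energy are almost isometric after projection to `V`. -/
theorem norm_one_sub_gram_le (h : SpectralGap A V Λ a b c) (hmN : m ≤ N) {ε : ℝ} (hε : 0 < ε) :
    ∃ η : ℝ, 0 < η ∧ ∀ X : Matrix (Fin N) (Fin m) ℂ, E0 (-A) X + Λ.trace.re ≤ η →
      ‖1 - (Vᴴ * X)ᴴ * (Vᴴ * X)‖ ≤ ε := by
  -- For `X = UR`, the defect is `1 - R²` plus the Gram matrix of `(U - VV*U)R`. The bound `δ ≤ 1`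
  -- gives `R² ≤ 2`, so each summand has norm at most `ε / 2`.
  set δ := min (ε / 2) 1 with hδ
  have hδ0 : 0 < δ := lt_min (by positivity) one_pos
  have hg : 0 < a - b := sub_pos.mpr h.lt
  refine ⟨min (c * δ ^ 2) ((a - b) * (ε / 4)),
    lt_min (mul_pos h.pos_c (by positivity)) (by positivity), fun X hX => ?_⟩
  obtain ⟨U, R, hU, hR, rfl⟩ := exists_polar hmN X
  have hRh := hR.isHermitian
  have h1 := h.energy_excess hU hRh
  have hc := h.pos_c
  have hq : ‖1 - R * R‖ ≤ δ := by
    have : c * ‖1 - R * R‖ ^ 2 ≤ c * δ ^ 2 := by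
      have := mul_nonneg hg.le (sq_nonneg ‖U - V * (Vᴴ * U)‖)
      linarith [min_le_left (c * δ ^ 2) ((a - b) * (ε / 4))]
    exact (sq_le_sq₀ (norm_nonneg _) hδ0.le).mp (le_of_mul_le_mul_left this hc)
  have hZ' : ‖U - V * (Vᴴ * U)‖ ^ 2 ≤ ε / 4 := by
    have : (a - b) * ‖U - V * (Vᴴ * U)‖ ^ 2 ≤ (a - b) * (ε / 4) := by
      have := mul_nonneg hc.le (sq_nonneg ‖1 - R * R‖)
      linarith [min_le_right (c * δ ^ 2) ((a - b) * (ε / 4))]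
    exact le_of_mul_le_mul_left this hg
  have hZ := h.conjTranspose_mul_compl (U * R)
  have hgram := h.gram_add (Y := Vᴴ * (U * R)) hZ
  rw [add_sub_cancel] at hgram
  have e1 : (U * R)ᴴ * (U * R) = R * R := by
    rw [conjTranspose_mul, hRh.eq, Matrix.mul_assoc, ← Matrix.mul_assoc Uᴴ, hU, Matrix.one_mul]
  have e2 : U * R - V * (Vᴴ * (U * R)) = (U - V * (Vᴴ * U)) * R := by
    rw [Matrix.sub_mul]; simp only [Matrix.mul_assoc]
  rw [e1, e2] at hgram
  have hZn : ‖(U - V * (Vᴴ * U)) * R‖ ^ 2 ≤ 2 * ‖U - V * (Vᴴ * U)‖ ^ 2 := by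
    set Z := U - V * (Vᴴ * U)
    have h2 := re_trace_mul_nonneg (posSemidef_norm_smul_one_sub
      (Q := -(1 - R * R)) (by simp [IsHermitian, conjTranspose_mul, hRh.eq]))
      (posSemidef_conjTranspose_mul_self Z)
    have e3 : (((Z * R)ᴴ) * (Z * R)).trace = (R * R * (Zᴴ * Z)).trace := by
      rw [conjTranspose_mul, hRh.eq, trace_mul_comm, Matrix.mul_assoc, trace_mul_comm]
      simp only [Matrix.mul_assoc]
    rw [frobenius_norm_sq (Z * R), e3]
    rw [norm_neg, Matrix.sub_mul, Matrix.smul_mul, Matrix.one_mul, Matrix.neg_mul, sub_neg_eq_add,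
      Matrix.sub_mul, Matrix.one_mul, trace_add, trace_sub, Complex.add_re, Complex.sub_re,
      re_trace_real_smul, ← frobenius_norm_sq] at h2
    have h3 : ‖1 - R * R‖ * ‖Z‖ ^ 2 ≤ 1 * ‖Z‖ ^ 2 :=
      mul_le_mul_of_nonneg_right (hq.trans (min_le_right _ _)) (sq_nonneg _)
    linarith
  have e4 : 1 - (Vᴴ * (U * R))ᴴ * (Vᴴ * (U * R)) = (1 - R * R) +
      ((U - V * (Vᴴ * U)) * R)ᴴ * ((U - V * (Vᴴ * U)) * R) := by
    rw [hgram]; abel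
  rw [e4]
  refine (norm_add_le _ _).trans ?_
  have h5 := frobenius_norm_mul_le ((U - V * (Vᴴ * U)) * R)ᴴ ((U - V * (Vᴴ * U)) * R)
  rw [frobenius_norm_conjTranspose, ← sq] at h5
  linarith [min_le_left (ε / 2) 1]

/-- A nearby matrix of the form `V U` with `U` unitary. -/
theorem exists_isometry_near (h : SpectralGap A V Λ a b c) (X : Matrix (Fin N) (Fin m) ℂ) :
    ∃ U : Matrix (Fin m) (Fin m) ℂ, Uᴴ * U = 1 ∧
      ‖X - V * U‖ ^ 2 ≤ ‖1 - (Vᴴ * X)ᴴ * (Vᴴ * X)‖ ^ 2 + ‖X - V * (Vᴴ * X)‖ ^ 2 := by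
  obtain ⟨U, R, hU, hR, hY⟩ := exists_polar le_rfl (Vᴴ * X)
  refine ⟨U, hU, ?_⟩
  have hZ := h.conjTranspose_mul_compl X
  -- Orthogonal summands, so Pythagoras applies; then `‖R - 1‖ ≤ ‖1 - R²‖`.
  have e1 : X - V * U = V * (U * (R - 1)) + (X - V * (Vᴴ * X)) := by
    rw [Matrix.mul_sub, ← hY, Matrix.mul_one, Matrix.mul_sub]; abel
  have e2 : (U * R)ᴴ * (U * R) = R * R := by
    rw [conjTranspose_mul, hR.isHermitian.eq, Matrix.mul_assoc, ← Matrix.mul_assoc Uᴴ, hU,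
      Matrix.one_mul]
  have e3 : (U * (R - 1))ᴴ * (U * (R - 1)) = (R - 1)ᴴ * (R - 1) := by
    rw [conjTranspose_mul, Matrix.mul_assoc, ← Matrix.mul_assoc Uᴴ, hU, Matrix.one_mul]
  rw [e1, frobenius_norm_sq, h.gram_add hZ, e3, trace_add, Complex.add_re, ← frobenius_norm_sq,
    ← frobenius_norm_sq, hY, e2]
  gcongr ?_ + _
  exact norm_sub_one_le hR

end SpectralGap

/-! ### Existence of minimizers and their distance -/

section Minimizers

variable {N m : ℕ}

theorem l1Norm_nonneg (X : Matrix (Fin N) (Fin m) ℂ) : 0 ≤ l1Norm X := by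
  unfold l1Norm; positivity

theorem l1Norm_sub_le (X Y : Matrix (Fin N) (Fin m) ℂ) :
    l1Norm Y - l1Norm X ≤ √((N : ℝ) * m) * ‖X - Y‖ := by
  have h1 : l1Norm Y - l1Norm X ≤ ∑ p : Fin N × Fin m, ‖(X - Y) p.1 p.2‖ := by
    rw [Fintype.sum_prod_type]
    simp only [l1Norm, ← Finset.sum_sub_distrib]
    gcongr with i _ j _
    rw [Matrix.sub_apply, norm_sub_rev]
    exact norm_sub_norm_le _ _
  refine h1.trans (Real.le_sqrt_of_sq_le (sq_sum_le_card_mul_sum_sq) |>.trans_eq ?_)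
  have e : ∑ p : Fin N × Fin m, ‖(X - Y) p.1 p.2‖ ^ 2 = ‖X - Y‖ ^ 2 := by
    rw [frobenius_norm_sq_eq_sum]
    exact Fintype.sum_prod_type _
  rw [e, Real.sqrt_mul (by positivity), Real.sqrt_sq (norm_nonneg _)]
  simp

theorem continuous_E (H : Matrix (Fin N) (Fin N) ℂ) (μ : ℝ) :
    Continuous (E (m := m) H μ) := by
  unfold E E0 traceE0 l1Norm
  fun_prop

theorem SpectralGap.nonempty_minimizers {A : Matrix (Fin N) (Fin N) ℂ}
    {V : Matrix (Fin N) (Fin m) ℂ} {Λ : Matrix (Fin m) (Fin m) ℂ} {a b c : ℝ}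
    (h : SpectralGap A V Λ a b c) (hmN : m ≤ N) {μ : ℝ} (hμ : 0 ≤ μ) :
    (S m (-A) μ).Nonempty := by
  have : ProperSpace (Matrix (Fin N) (Fin m) ℂ) := FiniteDimensional.proper ℂ _
  -- Chosen so that `c K² ≥ tr Λ`: then `‖1 - X*X‖ ≥ K` forces `E_μ(X) ≥ 0 = E_μ(0)`. If instead `‖1
  -- - X*X‖ < K`, then `‖X‖² ≤ B`, so this happens only on a bounded set.
  set K := |Λ.trace.re| / c + 1 with hK
  have hK1 : 1 ≤ K := by
    have := h.pos_c
    rw [hK, le_add_iff_nonneg_left]; positivity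
  have hcK : Λ.trace.re ≤ c * K ^ 2 := by
    have h1 : c * K = |Λ.trace.re| + c := by
      have := h.pos_c.ne'
      rw [hK]; field_simp
    have h2 : c * K ≤ c * K ^ 2 := mul_le_mul_of_nonneg_left (by nlinarith) h.pos_c.le
    linarith [le_abs_self Λ.trace.re, h.pos_c]
  set B := (1 : Matrix (Fin m) (Fin m) ℂ).trace.re + ‖(1 : Matrix (Fin m) (Fin m) ℂ)‖ * K
  have hev : ∀ᶠ X in Filter.cocompact (Matrix (Fin N) (Fin m) ℂ),
      E (-A) μ (0 : Matrix (Fin N) (Fin m) ℂ) ≤ E (-A) μ X := by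
    filter_upwards [tendsto_norm_cocompact_atTop.eventually_gt_atTop (|B| + 1)] with X hX
    have h0 : E (-A) μ (0 : Matrix (Fin N) (Fin m) ℂ) = 0 := by simp [E, E0, traceE0, l1Norm]
    have h1 : K ≤ ‖1 - Xᴴ * X‖ := by
      by_contra! hlt
      have h2 := re_trace_conjTranspose_mul_le (-1 : Matrix (Fin m) (Fin m) ℂ) (1 - Xᴴ * X)
      rw [conjTranspose_neg, conjTranspose_one, Matrix.neg_mul, Matrix.one_mul, trace_neg,
        trace_sub, Complex.neg_re, Complex.sub_re, ← frobenius_norm_sq, norm_neg] at h2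
      have h3 := mul_le_mul_of_nonneg_left hlt.le (norm_nonneg (1 : Matrix (Fin m) (Fin m) ℂ))
      have h4 : ‖X‖ ^ 2 ≤ |B| := by linarith [le_abs_self B]
      nlinarith [abs_nonneg B]
    have h2 := h.gram_lower_bound hmN X
    have h3 : c * K ^ 2 ≤ c * ‖1 - Xᴴ * X‖ ^ 2 := by
      have := h.pos_c
      gcongr
    rw [h0, E]
    have := mul_nonneg hμ (l1Norm_nonneg X)
    linarith
  obtain ⟨X, hX⟩ := (continuous_E (-A) μ).exists_forall_le' 0 hev
  exact ⟨X, fun Y _ => hX Y⟩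

theorem SpectralGap.mul_isometry_mem {A : Matrix (Fin N) (Fin N) ℂ}
    {V : Matrix (Fin N) (Fin m) ℂ} {Λ : Matrix (Fin m) (Fin m) ℂ} {a b c : ℝ}
    (h : SpectralGap A V Λ a b c) (hmN : m ≤ N) {U : Matrix (Fin m) (Fin m) ℂ}
    (hU : Uᴴ * U = 1) : V * U ∈ S m (-A) 0 := by
  intro X _
  simpa [E, h.E0_isometry hU] using h.le_E0 hmN X

theorem SpectralGap.exists_near_minimizer {A : Matrix (Fin N) (Fin N) ℂ}
    {V : Matrix (Fin N) (Fin m) ℂ} {Λ : Matrix (Fin m) (Fin m) ℂ} {a b c : ℝ}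
    (h : SpectralGap A V Λ a b c) (hmN : m ≤ N) {α : ℝ} (hα0 : 0 < α) (hα1 : α < 1) :
    ∃ μ₀ : ℝ, 0 < μ₀ ∧ ∀ μ : ℝ, 0 < μ → μ < μ₀ → ∀ X ∈ S m (-A) μ,
      ∃ X₀ ∈ S m (-A) 0, ‖X - X₀‖ ≤ μ * √((N : ℝ) * m) / (α * (a - b)) := by
  have hg : 0 < a - b := sub_pos.mpr h.lt
  have hb := h.pos_b
  have hab : 0 < a + b := by linarith
  have hα : 0 < 1 - α := sub_pos.mpr hα1
  obtain ⟨η, hη, hsmall⟩ := h.norm_one_sub_gram_le hmN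
    (ε := (1 - α) * (a - b) / (a + b)) (by positivity)
  have hl := l1Norm_nonneg V
  refine ⟨η / (l1Norm V + 1), by positivity, fun μ hμ hμ' X hX => ?_⟩
  have hmin : ∀ U : Matrix (Fin m) (Fin m) ℂ, Uᴴ * U = 1 →
      E0 (-A) X + Λ.trace.re ≤ μ * (l1Norm (V * U) - l1Norm X) := fun U hU => by
    have h1 : E (-A) μ X ≤ E (-A) μ (V * U) := hX (Set.mem_univ _)
    rw [E, E, h.E0_isometry hU] at h1
    linarith
  -- The fixed competitor `V`, i.e. `U = 1`, makes the excess at most `η`; the competitor near `X`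
  -- is used only afterwards.
  have hq := hsmall X (by
    have h1 := hmin 1 (by simp)
    rw [Matrix.mul_one] at h1
    rw [lt_div_iff₀ (by positivity)] at hμ'
    have := mul_nonneg hμ.le (l1Norm_nonneg X)
    linarith)
  obtain ⟨U, hU, hD⟩ := h.exists_isometry_near X
  refine ⟨V * U, h.mul_isometry_mem hmN hU, ?_⟩
  have hgrow := h.quadratic_growth (Y := Vᴴ * X) (h.conjTranspose_mul_compl X)
  rw [add_sub_cancel] at hgrow
  have h1 := hmin U hU
  have h2 := mul_le_mul_of_nonneg_left (l1Norm_sub_le X (V * U)) hμ.le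
  set q := ‖1 - (Vᴴ * X)ᴴ * (Vᴴ * X)‖
  set z := ‖X - V * (Vᴴ * X)‖
  set D := ‖X - V * U‖
  rw [le_div_iff₀ hab] at hq
  have h3 : α * (a - b) * z ^ 2 ≤ (a - b - (a + b) * q) * z ^ 2 :=
    mul_le_mul_of_nonneg_right (by linarith) (sq_nonneg _)
  have h4 : α * (a - b) * q ^ 2 ≤ a * q ^ 2 :=
    mul_le_mul_of_nonneg_right (by nlinarith) (sq_nonneg _)
  have h5 : α * (a - b) * D ^ 2 ≤ α * (a - b) * (q ^ 2 + z ^ 2) := by gcongr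
  have h6 : α * (a - b) * D ^ 2 ≤ μ * √((N : ℝ) * m) * D := by linarith
  rw [le_div_iff₀ (by positivity)]
  -- Cancelling a factor `D` requires `D ≠ 0`.
  rcases (norm_nonneg (X - V * U)).eq_or_lt with h0 | h0
  · rw [show D = 0 from h0.symm, zero_mul]; positivity
  · refine le_of_mul_le_mul_right ?_ h0
    change D * _ * D ≤ _ * D
    linarith

end Minimizers

end OMM

/-! ### The main theorem -/

theorem theorem2p8 (N m : ℕ) (hm : 0 < m) (hmN : m < N)
    (H : Matrix (Fin N) (Fin N) ℂ) (hH : H.IsHermitian) (hneg : (-H).PosDef)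
    (hgap : OMM.eig hH ⟨m - 1, by omega⟩ < OMM.eig hH ⟨m, hmN⟩)
    (α : ℝ) (hα0 : 0 < α) (hα1 : α < 1) :
    ∃ μ₀ : ℝ, 0 < μ₀ ∧ ∀ μ : ℝ, 0 < μ → μ < μ₀ →
      (OMM.S m H 0).Nonempty ∧ (OMM.S m H μ).Nonempty ∧
      OMM.d (OMM.S m H μ) (OMM.S m H 0) ≤
        ENNReal.ofReal (μ * Real.sqrt ((N : ℝ) * (m : ℝ)) /
          (α * (OMM.eig hH ⟨m, hmN⟩ - OMM.eig hH ⟨m - 1, by omega⟩))) := by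
  obtain ⟨V, Λ, c, h⟩ := OMM.exists_spectralGap hm hmN (by omega) hH hneg hgap
  obtain ⟨μ₀, hμ₀, hnear⟩ := h.exists_near_minimizer hmN.le hα0 hα1
  have hmin : ∀ {μ : ℝ}, 0 ≤ μ → (OMM.S m (- -H) μ).Nonempty := h.nonempty_minimizers hmN.le
  simp only [neg_neg, neg_sub_neg] at hnear hmin
  refine ⟨μ₀, hμ₀, fun μ hμ hμ' => ⟨hmin le_rfl, hmin hμ.le, iSup₂_le fun X hX => ?_⟩⟩
  obtain ⟨X₀, hX₀, hle⟩ := hnear μ hμ hμ' X hX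
  exact (iInf₂_le X₀ hX₀).trans (ENNReal.ofReal_le_ofReal hle)
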